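/- All graphs are finite. A signed simple graph $(G,\sigma)$ is a simple graph $G$ with a signature $\sigma:E(G)\to\{+,-\}$. For real $r\ge 1$ let $C^r$ be the circle of circumference $r$ with the shorter-arc distance $d$, and let $\bar x$ denote the antipodal point of $x\in C^r$. A circular $r$-coloring of $(G,\sigma)$ is a map $f:V(G)\to C^r$ with $d(f(u),f(v))\ge 1$ for every positive edge $uv$ and $d(f(u),\overline{f(v)})\ge 1$ for every negative edge $uv$; $\chi_c(G,\sigma)$ is the infimum of the $r\ge1$ for which $(G,\sigma)$ has a circular $r$-coloring. Let $\mathcal{SSP}$ be the class of signed series-parallel (that is, $K_4$-minor-free) simple graphs and $\mathcal{SO}$ the class of signed outerplanar simple graphs (those whose underlying graph can be embedded in a closed disc with all vertices on the boundary circle), and for a class $\mathcal C$ put $\chi_c(\mathcal C)=\sup\{\chi_c(G,\sigma):(G,\sigma)\in\mathcal C\}$. Theorem. $$\chi_c(\mathcal{SSP})=\chi_c(\mathcal{SO})=\frac{10}{3}.$$ Moreover: (1) Let $F$ be the signed graph on the six vertices $x,y,z,a,b,c$ with positive edges $yb, xa, zc$ and negative edges $xy, yz, xz, yc, xb, za$.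 Then $F$ is outerplanar, it has no circular $3$-coloring, and $\chi_c(F)=\frac{10}{3}$. (2) Let $SPal_5$ be the signed complete graph on the cyclically ordered vertices $0,1,2,3,4$ in which consecutive vertices are joined by negative edges and all other pairs by positive edges. Then every signed $K_4$-minor-free simple graph $(G,\sigma)$ admits a switching homomorphism to $SPal_5$: there are a set $A\subseteq V(G)$ and a map $V(G)\to V(SPal_5)$ that sends positive edges to positive edges and negative edges to negative edges after the signs of all edges between $A$ and $V(G)\setminus A$ have been reversed. -/

import Mathlib

/-- A signed simple graph: a simple graph together with a signature, i.e. a sign for every edge. -/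
structure SignedGraph (V : Type*) where
  graph : SimpleGraph V
  sign : graph.edgeSet → ℤˣ

namespace SignedGraph

variable {V W : Type*}

/-- `uv` is a positive edge. -/
def PosAdj (S : SignedGraph V) (u v : V) : Prop :=
  ∃ h : S.graph.Adj u v, S.sign ⟨s(u, v), h⟩ = 1

/-- `uv` is a negative edge. -/
def NegAdj (S : SignedGraph V) (u v : V) : Prop :=
  ∃ h : S.graph.Adj u v, S.sign ⟨s(u, v), h⟩ = -1

/-- The signed simple graph whose edges are the elements of `P ∪ N` (apart from diagonal ones), where
the edges in `N` are negative and all others are positive. -/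
def ofEdges [DecidableEq V] (P N : Finset (Sym2 V)) : SignedGraph V where
  graph := SimpleGraph.fromEdgeSet (P ∪ N : Finset (Sym2 V))
  sign e := if (e : Sym2 V) ∈ N then -1 else 1

/-- A circular `r`-coloring, for `0 < r`. The circle `C^r` of circumference `r` is `AddCircle r`;
its metric is the length of the shorter arc. The antipodal of `x` is `x + r / 2`. -/
def IsCircularColoring (S : SignedGraph V) (r : ℝ) (f : V → AddCircle r) : Prop :=
  (∀ u v, S.PosAdj u v → 1 ≤ dist (f u) (f v)) ∧
  (∀ u v, S.NegAdj u v → 1 ≤ dist (f u) (f v + ((r / 2 : ℝ) : AddCircle r)))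

/-- The signed graph admits a circular `r`-coloring. -/
def CircularColorable (S : SignedGraph V) (r : ℝ) : Prop :=
  ∃ f : V → AddCircle r, S.IsCircularColoring r f

/-- The circular chromatic number. -/
noncomputable def circularChromaticNumber (S : SignedGraph V) : ℝ :=
  sInf {r : ℝ | 1 ≤ r ∧ S.CircularColorable r}

open Classical in
/-- Switching at a set `A` of vertices: the sign of an edge is multiplied by `-1` once for each of
its ends that lies in `A`. -/
noncomputable def switch (S : SignedGraph V) (A : Set V) : SignedGraph V where
  graph := S.graph
  sign e := S.sign e *
    Sym2.lift ⟨fun u v => (if u ∈ A then (-1 : ℤˣ) else 1) * (if v ∈ A then (-1 : ℤˣ) else 1),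
      fun _ _ => mul_comm _ _⟩ (e : Sym2 V)

/-- An edge-sign preserving homomorphism. -/
def IsSignHom (S : SignedGraph V) (T : SignedGraph W) (f : V → W) : Prop :=
  (∀ u v, S.PosAdj u v → T.PosAdj (f u) (f v)) ∧
  (∀ u v, S.NegAdj u v → T.NegAdj (f u) (f v))

/-- `S` admits a switching homomorphism to `T`: some switching of `S` admits an edge-sign preserving
homomorphism to `T`. -/
def SwitchingHom (S : SignedGraph V) (T : SignedGraph W) : Prop :=
  ∃ A : Set V, ∃ f : V → W, (S.switch A).IsSignHom T f

/-- The signed Paley graph on five vertices: the complete graph on the cyclically ordered vertices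
`0, 1, 2, 3, 4`, where consecutive vertices are joined by negative edges and all other pairs
by positive edges. -/
def SPal5 : SignedGraph (Fin 5) :=
  ofEdges {s(0, 2), s(1, 3), s(2, 4), s(3, 0), s(4, 1)}
    {s(0, 1), s(1, 2), s(2, 3), s(3, 4), s(4, 0)}

/-- The signed graph `F`, with vertices `x = 0`, `y = 1`, `z = 2`, `a = 3`, `b = 4`, `c = 5`:
positive edges `yb, xa, zc`; negative edges `xy, yz, xz, yc, xb, za`. -/
def F : SignedGraph (Fin 6) :=
  ofEdges {s(1, 4), s(0, 3), s(2, 5)}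
    {s(0, 1), s(1, 2), s(0, 2), s(1, 5), s(0, 4), s(2, 3)}

/-- The circular chromatic numbers of all finite signed simple graphs whose underlying graph belongs
to the class `P`. -/
def circularChromaticNumbers (P : ∀ V : Type, SimpleGraph V → Prop) : Set ℝ :=
  {x | ∃ (V : Type) (_ : Finite V) (S : SignedGraph V),
    P V S.graph ∧ x = S.circularChromaticNumber}

end SignedGraph

namespace SimpleGraph

variable {V W : Type*}

/-- `H` is a minor of `G`: there are pairwise disjoint (nonempty) connected vertex sets of `G`, one for
each vertex of `H`, with an edge of `G` between the sets of any two adjacent vertices of `H`. -/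
def IsMinorOf (H : SimpleGraph W) (G : SimpleGraph V) : Prop :=
  ∃ B : W → Set V,
    (∀ w, (G.induce (B w)).Connected) ∧
    (∀ w w', w ≠ w' → Disjoint (B w) (B w')) ∧
    (∀ w w', H.Adj w w' → ∃ u ∈ B w, ∃ v ∈ B w', G.Adj u v)

/-- Series-parallel graphs: the graphs without a `K_4` minor. -/
def IsSeriesParallel (G : SimpleGraph V) : Prop :=
  ¬ (completeGraph (Fin 4)).IsMinorOf G

/-- Outerplanar graphs: the graphs that can be embedded in the closed unit disc with all vertices on
the boundary circle. Here `p` places the vertices, and `γ e` is a simple arc in the disc that joins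
the ends of the edge `e`; no inner point of an arc is a vertex or an inner point of another arc. -/
def IsOuterplanar (G : SimpleGraph V) : Prop :=
  ∃ (p : V → ℂ) (γ : G.edgeSet → C(unitInterval, ℂ)),
    Function.Injective p ∧
    (∀ v, p v ∈ Metric.sphere (0 : ℂ) 1) ∧
    (∀ e, Function.Injective (γ e)) ∧
    (∀ e t, γ e t ∈ Metric.closedBall (0 : ℂ) 1) ∧
    (∀ e, s(γ e 0, γ e 1) = Sym2.map p (e : Sym2 V)) ∧
    (∀ e, ∀ t ∈ Set.Ioo (0 : unitInterval) 1, γ e t ∉ Set.range p) ∧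
    (∀ e e', e ≠ e' → ∀ t ∈ Set.Ioo (0 : unitInterval) 1, ∀ t' ∈ Set.Ioo (0 : unitInterval) 1,
      γ e t ≠ γ e' t')

end SimpleGraph

/-! Both suprema are squeezed between an upper bound valid for all series-parallel graphs and the
lower bound given by the single outerplanar graph `F`.

Upper bound: a nonempty `K₄`-minor-free graph has a vertex of degree at most two
(`exists_degree_le_two`). Remove it; if it has two neighbours, contract it into one of them, so that
they get distinct colours. The colouring extends because in the signed Paley graph two distinct
vertices are joined by a path of length two of either sign product (`exists_paleySign_eq`). This
gives a switching homomorphism to that graph, whose vertices are placed equally spaced on the circle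
of circumference `10/3`, with switching acting as the antipodal map.

Lower bound: in a circular `r`-colouring the ends of a negative edge are at distance at most `r/2 -
1`. In `F` each edge of the negative triangle `xyz` also spans a path with one positive and one
negative edge, which forces its ends to distance at least `2 - r/2`. Three such points exist only if
`r ≥ 10/3`.

That outerplanar graphs are series-parallel is topological: two arcs in a disc with interleaved ends
meet (`exists_eq_of_interleaved_ends`), while a `K₄` minor would force two edges with interleaved
ends (`isSeriesParallel_of_not_interleaved`). -/

namespace SimpleGraph

/-! ### Connected vertex sets, contractions and `K₄` minors. -/

variable {V : Type*} {G : SimpleGraph V}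

/-- A connected vertex set that meets both a set `t` and its complement has an edge leaving `t`. -/
theorem exists_adj_of_connected_induce {s : Set V} (h : (G.induce s).Connected) (t : Set V)
    {a b : V} (ha : a ∈ s) (hat : a ∈ t) (hb : b ∈ s) (hbt : b ∉ t) :
    ∃ u ∈ s, ∃ v ∈ s, u ∈ t ∧ v ∉ t ∧ G.Adj u v := by
  by_contra! hcon
  obtain ⟨p⟩ := h.preconnected ⟨a, ha⟩ ⟨b, hb⟩
  have key : ∀ (u v : s) (_ : (G.induce s).Walk u v), (u : V) ∈ t → (v : V) ∈ t := by
    intro u v p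
    induction p with
    | nil => exact id
    | @cons u w _ huw _ ih =>
      intro hu
      apply ih
      by_contra hw
      exact hcon u u.2 w w.2 hu hw huw
  exact hbt (key _ _ p hat)

/-- A vertex set is connected if it is the only subset of itself that contains a given vertex and is
closed under adjacency. -/
theorem connected_induce_of_closed {s : Set V} {x : V} (hx : x ∈ s)
    (h : ∀ t : Set V, x ∈ t → (∀ u ∈ s, ∀ v ∈ s, u ∈ t → G.Adj u v → v ∈ t) → s ⊆ t) :
    (G.induce s).Connected := by
  rw [connected_iff_exists_forall_reachable]
  refine ⟨⟨x, hx⟩, fun ⟨v, hv⟩ => ?_⟩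
  have := h {v | ∃ hv : v ∈ s, (G.induce s).Reachable ⟨x, hx⟩ ⟨v, hv⟩} ⟨hx, Reachable.refl _⟩
    (fun u _ w hw ⟨hu, hr⟩ huw => ⟨hw, hr.trans (Adj.reachable (by exact huw))⟩) hv
  exact this.2

theorem connected_induce_singleton (x : V) : (G.induce {x}).Connected :=
  connected_induce_of_closed rfl fun t ht _ => by simpa using ht

/-- The contraction of `c` into `x`: every neighbour of `c` becomes a neighbour of `x`. The vertex `c`
itself is kept, and is meant to be left out afterwards. -/
def contract (G : SimpleGraph V) (x c : V) : SimpleGraph V where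
  Adj a b := G.Adj a b ∨ (a = x ∧ b ≠ x ∧ G.Adj c b) ∨ (b = x ∧ a ≠ x ∧ G.Adj c a)
  symm := ⟨fun a b h => by
    rcases h with h | h | h
    · exact Or.inl h.symm
    · exact Or.inr (Or.inr h)
    · exact Or.inr (Or.inl h)⟩
  loopless := ⟨fun a h => by
    rcases h with h | h | h
    · exact h.ne rfl
    · exact h.2.1 h.1
    · exact h.2.1 h.1⟩

/-- `G` has a `K₄` minor all of whose branch sets lie in `S`. -/
def HasK4MinorOn (G : SimpleGraph V) (S : Set V) : Prop :=
  ∃ B : Fin 4 → Set V, (∀ i, B i ⊆ S) ∧ (∀ i, (G.induce (B i)).Connected) ∧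
    (∀ i j, i ≠ j → Disjoint (B i) (B j)) ∧
    (∀ i j, i ≠ j → ∃ u ∈ B i, ∃ v ∈ B j, G.Adj u v)

theorem HasK4MinorOn.mono {S T : Set V} (h : G.HasK4MinorOn S) (hST : S ⊆ T) :
    G.HasK4MinorOn T := by
  obtain ⟨B, h1, h2⟩ := h
  exact ⟨B, fun i => (h1 i).trans hST, h2⟩

theorem HasK4MinorOn.not_isSeriesParallel {S : Set V} (h : G.HasK4MinorOn S) :
    ¬ G.IsSeriesParallel := by
  obtain ⟨B, -, h2, h3, h4⟩ := h
  exact fun hG => hG ⟨B, h2, h3, fun i j hij => h4 i j hij⟩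

/-- Putting `c` back into the branch set of `x`, if there is one, restores all adjacencies: every
edge created by the contraction is at `x` and stems from an edge at `c`. -/
theorem HasK4MinorOn.of_contract {S : Set V} {x c : V} (hxc : G.Adj x c) (hc : c ∈ S)
    (h : (G.contract x c).HasK4MinorOn (S \ {c})) : G.HasK4MinorOn S := by
  classical
  obtain ⟨B, h1, h2, h3, h4⟩ := h
  have hcB : ∀ i, c ∉ B i := fun i hi => (h1 i hi).2 rfl
  have hsub : ∀ i, B i ⊆ if x ∈ B i then insert c (B i) else B i := by
    intro i
    split_ifs
    · exact Set.subset_insert _ _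
    · exact subset_rfl
  refine ⟨fun i => if x ∈ B i then insert c (B i) else B i, ?_, ?_, ?_, ?_⟩
  · intro i
    dsimp only
    split_ifs
    · exact Set.insert_subset hc fun v hv => (h1 i hv).1
    · exact fun v hv => (h1 i hv).1
  · intro i
    show (G.induce (if x ∈ B i then insert c (B i) else B i)).Connected
    by_cases hx : x ∈ B i
    · rw [if_pos hx]
      refine connected_induce_of_closed (Set.mem_insert_of_mem _ hx) fun t hxt ht => ?_
      have hct : c ∈ t := ht x (Set.mem_insert_of_mem _ hx) c (Set.mem_insert _ _) hxt hxc
      refine Set.insert_subset hct fun b hb => ?_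
      by_contra hbt
      obtain ⟨u, hu, v, hv, hut, hvt, huv⟩ := exists_adj_of_connected_induce (h2 i) t hx hxt hb hbt
      rcases huv with huv | huv | huv
      · exact hvt (ht u (Set.mem_insert_of_mem _ hu) v (Set.mem_insert_of_mem _ hv) hut huv)
      · exact hvt (ht c (Set.mem_insert _ _) v (Set.mem_insert_of_mem _ hv) hct huv.2.2)
      · exact hvt (huv.1 ▸ hxt)
    · rw [if_neg hx]
      obtain ⟨⟨y, hy⟩⟩ := (h2 i).nonempty
      refine connected_induce_of_closed hy fun t hyt ht b hb => ?_
      by_contra hbt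
      obtain ⟨u, hu, v, hv, hut, hvt, huv⟩ := exists_adj_of_connected_induce (h2 i) t hy hyt hb hbt
      rcases huv with huv | huv | huv
      · exact hvt (ht u hu v hv hut huv)
      · exact hx (huv.1 ▸ hu)
      · exact hx (huv.1 ▸ hv)
  · intro i j hij
    have hd := h3 i j hij
    dsimp only
    split_ifs with hi hj hj
    · exact absurd hj (Set.disjoint_left.1 hd hi)
    · exact Set.disjoint_insert_left.2 ⟨hcB j, hd⟩
    · exact Set.disjoint_insert_right.2 ⟨hcB i, hd⟩
    · exact hd
  · intro i j hij
    obtain ⟨u, hu, v, hv, huv⟩ := h4 i j hij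
    rcases huv with huv | ⟨rfl, -, huv⟩ | ⟨rfl, -, huv⟩
    · exact ⟨u, hsub i hu, v, hsub j hv, huv⟩
    · exact ⟨c, by simp [hu], v, hsub j hv, huv⟩
    · exact ⟨u, hsub i hu, c, by simp [hv], huv.symm⟩

open Classical in
/-- Contraction of `c` into `x` does not lower the degree of a vertex that is not a common neighbour
of `c` and `x`. -/
theorem card_neighbors_le_contract {S : Finset V} {x c v : V} (hx : x ∈ S) (hxc : x ≠ c)
    (hvx : v ≠ x) (hv : ¬ (G.Adj v c ∧ G.Adj v x)) :
    (S.filter (G.Adj v)).card ≤ ((S.erase c).filter ((G.contract x c).Adj v)).card := by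
  by_cases hvc : G.Adj v c
  · have hvx' : ¬ G.Adj v x := fun h => hv ⟨hvc, h⟩
    have hsub : insert x ((S.filter (G.Adj v)).erase c) ⊆
        (S.erase c).filter ((G.contract x c).Adj v) := by
      intro b hb
      rcases Finset.mem_insert.1 hb with rfl | hb
      · exact Finset.mem_filter.2 ⟨Finset.mem_erase.2 ⟨hxc, hx⟩, Or.inr (Or.inr ⟨rfl, hvx, hvc.symm⟩)⟩
      · simp only [Finset.mem_erase, Finset.mem_filter] at hb ⊢
        exact ⟨⟨hb.1, hb.2.1⟩, Or.inl hb.2.2⟩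
    refine le_trans ?_ (Finset.card_le_card hsub)
    rw [Finset.card_insert_of_notMem (by simp [hvx'])]
    have := Finset.pred_card_le_card_erase (s := S.filter (G.Adj v)) (a := c)
    omega
  · refine Finset.card_le_card fun b hb => ?_
    simp only [Finset.mem_erase, Finset.mem_filter] at hb ⊢
    exact ⟨⟨fun h => hvc (h ▸ hb.2), hb.1⟩, Or.inl hb.2⟩

open Classical in
/-- Contraction of `c` into `x` lowers the degree of a vertex by at most one. -/
theorem card_neighbors_le_contract_succ {S : Finset V} {x c v : V} :
    (S.filter (G.Adj v)).card ≤ ((S.erase c).filter ((G.contract x c).Adj v)).card + 1 := by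
  have hsub : (S.filter (G.Adj v)).erase c ⊆ (S.erase c).filter ((G.contract x c).Adj v) := by
    intro b hb
    simp only [Finset.mem_erase, Finset.mem_filter] at hb ⊢
    exact ⟨⟨hb.1, hb.2.1⟩, Or.inl hb.2.2⟩
  have := Finset.card_le_card hsub
  have := Finset.pred_card_le_card_erase (s := S.filter (G.Adj v)) (a := c)
  omega

/-! ### Dirac's theorem on vertices of small degree. -/

/-- The four sets `{a}`, `{b}`, `{x}`, `D` form a `K₄` minor. -/
theorem hasK4MinorOn_of_triangle {S D : Set V} {a b x : V} (ha : a ∈ S) (hb : b ∈ S) (hx : x ∈ S)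
    (hD : D ⊆ S) (hDc : (G.induce D).Connected) (haD : a ∉ D) (hbD : b ∉ D) (hxD : x ∉ D)
    (hab : G.Adj a b) (hax : G.Adj a x) (hbx : G.Adj b x)
    (haD' : ∃ v ∈ D, G.Adj a v) (hbD' : ∃ v ∈ D, G.Adj b v) (hxD' : ∃ v ∈ D, G.Adj x v) :
    G.HasK4MinorOn S := by
  obtain ⟨va, hva, hva'⟩ := haD'
  obtain ⟨vb, hvb, hvb'⟩ := hbD'
  obtain ⟨vx, hvx, hvx'⟩ := hxD'
  refine ⟨![{a}, {b}, {x}, D], ?_, ?_, ?_, ?_⟩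
  · intro i
    fin_cases i <;> simp [ha, hb, hx, hD]
  · intro i
    fin_cases i
    · exact connected_induce_singleton a
    · exact connected_induce_singleton b
    · exact connected_induce_singleton x
    · exact hDc
  · intro i j hij
    fin_cases i <;> fin_cases j <;>
      simp [haD, hbD, hxD, hab.ne, hax.ne, hbx.ne, hab.ne', hax.ne', hbx.ne'] at hij ⊢
  · intro i j hij
    fin_cases i <;> fin_cases j <;> simp [hab, hax, hbx, hab.symm, hax.symm, hbx.symm] at hij ⊢
    · exact ⟨va, hva, hva'⟩
    · exact ⟨vb, hvb, hvb'⟩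
    · exact ⟨vx, hvx, hvx'⟩
    · exact ⟨va, hva, hva'.symm⟩
    · exact ⟨vb, hvb, hvb'.symm⟩
    · exact ⟨vx, hvx, hvx'.symm⟩

open Classical in
/-- A vertex of degree three with two known neighbours has exactly one further neighbour. -/
theorem exists_third_neighbor {S : Finset V} {v a b : V} (h : (S.filter (G.Adj v)).card = 3)
    (ha : a ∈ S) (hb : b ∈ S) (hab : a ≠ b) (hva : G.Adj v a) (hvb : G.Adj v b) :
    ∃ w ∈ S, w ≠ a ∧ w ≠ b ∧ G.Adj v w ∧ ∀ u ∈ S, G.Adj v u → u = a ∨ u = b ∨ u = w := by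
  have hmem : ∀ u, u ∈ S.filter (G.Adj v) ↔ u ∈ S ∧ G.Adj v u := fun u => Finset.mem_filter
  have hc : (((S.filter (G.Adj v)).erase a).erase b).card = 1 := by
    rw [Finset.card_erase_of_mem (Finset.mem_erase.2 ⟨hab.symm, (hmem b).2 ⟨hb, hvb⟩⟩),
      Finset.card_erase_of_mem ((hmem a).2 ⟨ha, hva⟩), h]
  obtain ⟨w, hw⟩ := Finset.card_eq_one.1 hc
  have hw' : ∀ u, (u ≠ b ∧ u ≠ a ∧ u ∈ S ∧ G.Adj v u) ↔ u = w := by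
    intro u
    rw [← Finset.mem_singleton, ← hw, Finset.mem_erase, Finset.mem_erase, hmem]
  obtain ⟨h1, h2, h3, h4⟩ := (hw' w).2 rfl
  refine ⟨w, h3, h2, h1, h4, fun u hu hvu => ?_⟩
  by_cases hua : u = a
  · exact Or.inl hua
  · by_cases hub : u = b
    · exact Or.inr (Or.inl hub)
    · exact Or.inr (Or.inr ((hw' u).1 ⟨hub, hua, hu, hvu⟩))

open Classical in
/-- **Dirac's theorem**: if all vertices but possibly one have degree at least three, there is a `K₄`
minor. -/
theorem hasK4MinorOn_of_three_le_degree (S : Finset V) (G : SimpleGraph V) (x : V) (hx : x ∈ S)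
    (hS : 2 ≤ S.card) (hdeg : ∀ v ∈ S, v ≠ x → 3 ≤ (S.filter (G.Adj v)).card) :
    G.HasK4MinorOn (S : Set V) := by
  induction hn : S.card using Nat.strong_induction_on generalizing S G x with
  | _ n ih =>
    subst hn
    -- every edge at `x` lies in a triangle whose third vertex has degree three, or we are done
    by_contra hK
    have h4 : 4 ≤ S.card := by
      obtain ⟨v, hv, hvx⟩ := Finset.exists_mem_ne (s := S) (by omega) x
      have h3 := hdeg v hv hvx
      have : S.filter (G.Adj v) ⊆ S.erase v := by
        intro u hu
        rw [Finset.mem_filter] at hu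
        exact Finset.mem_erase.2 ⟨hu.2.ne', hu.1⟩
      have := Finset.card_le_card this
      rw [Finset.card_erase_of_mem hv] at this
      omega
    -- The induction hypothesis in contrapositive form: no contraction may preserve the degree
    -- condition.
    have contr : ∀ a ∈ S, ∀ c ∈ S, G.Adj a c → c ≠ x →
        (∀ v ∈ S, v ≠ c → v ≠ x → 3 ≤ ((S.erase c).filter ((G.contract a c).Adj v)).card) →
        False := by
      intro a ha c hc hac hcx h
      apply hK
      refine HasK4MinorOn.of_contract hac hc ?_
      have hcard : (S.erase c).card = S.card - 1 := Finset.card_erase_of_mem hc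
      have := ih (S.erase c).card (by omega) (S.erase c) (G.contract a c) x
        (Finset.mem_erase.2 ⟨hcx.symm, hx⟩) (by omega)
        (fun v hv hvx => h v (Finset.mem_erase.1 hv).2 (Finset.mem_erase.1 hv).1 hvx) rfl
      rwa [Finset.coe_erase] at this
    have tri : ∀ c ∈ S, G.Adj x c →
        ∃ v ∈ S, G.Adj x v ∧ G.Adj c v ∧ (S.filter (G.Adj v)).card = 3 := by
      intro c hc hxc
      by_contra! hno
      refine contr x hx c hc hxc hxc.ne' fun v hv hvc hvx => ?_
      by_cases hcom : G.Adj v c ∧ G.Adj v x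
      · have h1 := hno v hv hcom.2.symm hcom.1.symm
        have h2 := hdeg v hv hvx
        have h3 := card_neighbors_le_contract_succ (G := G) (S := S) (x := x) (c := c) (v := v)
        omega
      · exact (hdeg v hv hvx).trans (card_neighbors_le_contract hx hxc.ne hvx hcom)
    by_cases hiso : ∃ c ∈ S, G.Adj x c
    · obtain ⟨c, hc, hxc⟩ := hiso
      obtain ⟨a, ha, hxa, -, hda⟩ := tri c hc hxc
      -- Using the triangle property a second time, on the edge `xa`, yields a triangle `x, a, b` in
      -- which both `a` and `b` have degree three.
      obtain ⟨b, hb, hxb, hab, hdb⟩ := tri a ha hxa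
      obtain ⟨w, hw, hwx, hwb, haw, hNa⟩ :=
        exists_third_neighbor hda hx hb hxb.ne hxa.symm hab
      obtain ⟨w', hw', hwx', hwa', hbw', hNb⟩ :=
        exists_third_neighbor hdb hx ha hxa.ne hxb.symm hab.symm
      by_cases hww : w = w'
      · subst hww
        set T : Set V := {v | v ∈ S ∧ v ≠ a ∧ v ≠ b ∧ v ≠ x} with hT
        have hwT : w ∈ T := ⟨hw, hwa', hwb, hwx⟩
        set D : Set V := {v | ∃ hv : v ∈ T, (G.induce T).Reachable ⟨w, hwT⟩ ⟨v, hv⟩} with hD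
        have hwD : w ∈ D := ⟨hwT, Reachable.refl _⟩
        have hDT : D ⊆ T := fun v hv => hv.1
        have hDcl : ∀ u ∈ D, ∀ v ∈ T, G.Adj u v → v ∈ D := fun u hu v hv huv =>
          ⟨hv, hu.2.trans (Adj.reachable (by exact huv))⟩
        by_cases hxD : ∃ v ∈ D, G.Adj x v
        · refine hK (hasK4MinorOn_of_triangle ha hb hx (fun v hv => (hDT hv).1) ?_
            (fun h => (hDT h).2.1 rfl) (fun h => (hDT h).2.2.1 rfl) (fun h => (hDT h).2.2.2 rfl)
            hab hxa.symm hxb.symm ⟨w, hwD, haw⟩ ⟨w, hwD, hbw'⟩ hxD)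
          refine connected_induce_of_closed hwD fun t hwt ht v hv => ?_
          have key : ∀ (u v : T) (_ : (G.induce T).Walk u v), (u : V) ∈ D → (u : V) ∈ t →
              (v : V) ∈ t := by
            intro u v p
            induction p with
            | nil => exact fun _ => id
            | @cons u y _ huy _ ih =>
              intro hu hut
              have hy := hDcl u hu y y.2 huy
              exact ih hy (ht u hu y hy hut huy)
          obtain ⟨hvT, ⟨p⟩⟩ := hv
          exact key _ _ p hwD hwt
        -- Now only `w` can have neighbours outside `D`, so the induction applies to `D` with `w` as
        -- the exceptional vertex. A third neighbour of `w` ensures that `D` has two vertices.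
        · push Not at hxD
          have hNw : ∀ v ∈ D, ∀ u ∈ S, G.Adj v u → v ≠ w → u ∈ D := by
            intro v hv u hu hvu hvw
            have hv' := hDT hv
            refine hDcl v hv u ⟨hu, ?_, ?_, ?_⟩ hvu
            · rintro rfl
              rcases hNa v hv'.1 hvu.symm with h | h | h
              · exact hv'.2.2.2 h
              · exact hv'.2.2.1 h
              · exact hvw h
            · rintro rfl
              rcases hNb v hv'.1 hvu.symm with h | h | h
              · exact hv'.2.2.2 h
              · exact hv'.2.1 h
              · exact hvw h
            · rintro rfl
              exact hxD v hv hvu.symm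
          have hDF : ∀ v, v ∈ S.filter (· ∈ D) ↔ v ∈ D := fun v => by
            rw [Finset.mem_filter]
            exact ⟨fun h => h.2, fun h => ⟨(hDT h).1, h⟩⟩
          have hlt : (S.filter (· ∈ D)).card < S.card := by
            refine Finset.card_lt_card ⟨Finset.filter_subset _ _, fun h => ?_⟩
            exact (hDT ((hDF x).1 (h hx))).2.2.2 rfl
          have h2 : 2 ≤ (S.filter (· ∈ D)).card := by
            have hdw := hdeg w hw hwx
            have : ¬ S.filter (G.Adj w) ⊆ {a, b} := fun h => by
              have := Finset.card_le_card h
              have := Finset.card_le_two (a := a) (b := b)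
              omega
            obtain ⟨u, hu, hu'⟩ := Finset.not_subset.1 this
            rw [Finset.mem_filter] at hu
            simp only [Finset.mem_insert, Finset.mem_singleton, not_or] at hu'
            have hux : u ≠ x := fun h => hxD w hwD (h ▸ hu.2.symm)
            have huD : u ∈ D := hDcl w hwD u ⟨hu.1, hu'.1, hu'.2, hux⟩ hu.2
            exact Finset.one_lt_card.2 ⟨w, (hDF w).2 hwD, u, (hDF u).2 huD, hu.2.ne⟩
          have := ih _ hlt (S.filter (· ∈ D)) G w ((hDF w).2 hwD) h2 (fun v hv hvw => by
            rw [hDF] at hv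
            refine (hdeg v (hDT hv).1 (hDT hv).2.2.2).trans (Finset.card_le_card fun u hu => ?_)
            rw [Finset.mem_filter] at hu ⊢
            exact ⟨(hDF u).2 (hNw v hv u hu.1 hu.2 hvw), hu.2⟩) rfl
          exact hK (this.mono fun v hv => (hDT ((hDF v).1 hv)).1)
      -- The only common neighbour of `a` and `b` is `x`, so contracting `b` into `a` lowers no
      -- other degree, and `a` keeps the neighbours `x`, `w`, `w'`.
      · refine contr a ha b hb hab hxb.ne' fun v hv hvb hvx => ?_
        by_cases hva : v = a
        · subst hva
          have hsub : ({x, w, w'} : Finset V) ⊆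
              (S.erase b).filter ((G.contract v b).Adj v) := by
            intro u hu
            simp only [Finset.mem_insert, Finset.mem_singleton] at hu
            rw [Finset.mem_filter, Finset.mem_erase]
            rcases hu with rfl | rfl | rfl
            · exact ⟨⟨hxb.ne, hx⟩, Or.inl hxa.symm⟩
            · exact ⟨⟨hwb, hw⟩, Or.inl haw⟩
            · exact ⟨⟨hbw'.ne', hw'⟩, Or.inr (Or.inl ⟨rfl, hwa', hbw'⟩)⟩
          have hc3 : ({x, w, w'} : Finset V).card = 3 :=
            Finset.card_eq_three.2 ⟨x, w, w', hwx.symm, hwx'.symm, hww, rfl⟩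
          exact hc3 ▸ Finset.card_le_card hsub
        · refine (hdeg v hv hvx).trans (card_neighbors_le_contract ha hab.ne hva ?_)
          rintro ⟨h1, h2⟩
          rcases hNa v hv h2.symm with h | h | h
          · exact hvx h
          · exact hvb h
          · rcases hNb v hv h1.symm with h' | h' | h'
            · exact hvx h'
            · exact hva h'
            · exact hww (h.symm.trans h')
    -- An isolated `x` can be deleted; any other vertex then takes the exceptional role.
    · push Not at hiso
      have hcard : (S.erase x).card = S.card - 1 := Finset.card_erase_of_mem hx
      obtain ⟨y, hy⟩ : (S.erase x).Nonempty := Finset.card_pos.1 (by omega)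
      refine hK ((ih _ (by omega) (S.erase x) G y hy (by omega) (fun v hv _ => ?_) rfl).mono
        fun v hv => (Finset.mem_erase.1 hv).2)
      rw [Finset.mem_erase] at hv
      refine (hdeg v hv.2 hv.1).trans (Finset.card_le_card fun u hu => ?_)
      rw [Finset.mem_filter] at hu ⊢
      exact ⟨Finset.mem_erase.2 ⟨fun h => hiso v hv.2 (h ▸ hu.2.symm), hu.1⟩, hu.2⟩

open Classical in
/-- Every nonempty `K₄`-minor-free graph has a vertex of degree at most two. -/
theorem exists_degree_le_two {S : Finset V} (hS : S.Nonempty)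
    (hG : ¬ G.HasK4MinorOn (S : Set V)) : ∃ v ∈ S, (S.filter (G.Adj v)).card ≤ 2 := by
  by_contra! h
  obtain ⟨x, hx⟩ := hS
  refine hG (hasK4MinorOn_of_three_le_degree S G x hx ?_ fun v hv _ => h v hv)
  exact (h x hx).le.trans' (by omega) |>.trans (Finset.card_filter_le _ _)

end SimpleGraph

/-! ### Colourings by the signed Paley graph. -/

/-- The signs of the edges of the signed Paley graph on five vertices. -/
def paleySign (i j : Fin 5) : ℤˣ := if i - j = 1 ∨ j - i = 1 then -1 else 1

theorem paleySign_comm (i j : Fin 5) : paleySign i j = paleySign j i := by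
  unfold paleySign
  simp only [or_comm]

/-- This is the extension step at a vertex of degree two: `k` is its colour and `η` records whether
it is switched. -/
theorem exists_paleySign_eq (i j : Fin 5) (hij : i ≠ j) (s t : ℤˣ) :
    ∃ (k : Fin 5) (η : ℤˣ), (k ≠ i ∧ paleySign k i = η * s) ∧ (k ≠ j ∧ paleySign k j = η * t) := by
  revert i j s t
  decide

namespace SimpleGraph

variable {V : Type*}

-- The signs `σ` are given on all pairs, so that a contraction can add an edge without touching
-- them. Of the added edge only the distinctness of the end colours is used.
open Classical in
theorem exists_paley_coloring (S : Finset V) (G : SimpleGraph V) (σ : V → V → ℤˣ)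
    (hσ : ∀ u v, σ u v = σ v u) (hG : ¬ G.HasK4MinorOn (S : Set V)) :
    ∃ (f : V → Fin 5) (ε : V → ℤˣ), ∀ u ∈ S, ∀ v ∈ S, G.Adj u v →
      f u ≠ f v ∧ paleySign (f u) (f v) = ε u * ε v * σ u v := by
  induction hn : S.card using Nat.strong_induction_on generalizing S G with
  | _ n ih =>
    subst hn
    rcases S.eq_empty_or_nonempty with rfl | hS
    · exact ⟨fun _ => 0, fun _ => 1, by simp⟩
    obtain ⟨w, hw, hdw⟩ := exists_degree_le_two hS hG
    have hlt : (S.erase w).card < S.card := Finset.card_erase_lt_of_mem hw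
    -- extending a colouring to `w`
    have extend : ∀ (f : V → Fin 5) (ε : V → ℤˣ) (k : Fin 5) (η : ℤˣ),
        (∀ u ∈ S.erase w, ∀ v ∈ S.erase w, G.Adj u v →
          f u ≠ f v ∧ paleySign (f u) (f v) = ε u * ε v * σ u v) →
        (∀ u ∈ S, G.Adj w u → k ≠ f u ∧ paleySign k (f u) = η * (ε u * σ w u)) →
        ∃ (f : V → Fin 5) (ε : V → ℤˣ), ∀ u ∈ S, ∀ v ∈ S, G.Adj u v →
          f u ≠ f v ∧ paleySign (f u) (f v) = ε u * ε v * σ u v := by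
      intro f ε k η hf hk
      refine ⟨Function.update f w k, Function.update ε w η, fun u hu v hv huv => ?_⟩
      by_cases huw : u = w
      · subst huw
        rw [Function.update_self, Function.update_self, Function.update_of_ne huv.ne',
          Function.update_of_ne huv.ne', mul_assoc]
        exact hk v hv huv
      · by_cases hvw : v = w
        · subst hvw
          rw [Function.update_self, Function.update_self, Function.update_of_ne huw,
            Function.update_of_ne huw, paleySign_comm, hσ, mul_comm (ε u), mul_assoc]
          exact ⟨(hk u hu huv.symm).1.symm, (hk u hu huv.symm).2⟩
        · rw [Function.update_of_ne huw, Function.update_of_ne hvw, Function.update_of_ne huw,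
            Function.update_of_ne hvw]
          exact hf u (Finset.mem_erase.2 ⟨huw, hu⟩) v (Finset.mem_erase.2 ⟨hvw, hv⟩) huv
    have hG' : ¬ G.HasK4MinorOn ((S.erase w : Finset V) : Set V) := fun h =>
      hG (h.mono (by exact_mod_cast Finset.erase_subset w S))
    have hmem : ∀ u, u ∈ S.filter (G.Adj w) ↔ u ∈ S ∧ G.Adj w u := fun u => Finset.mem_filter
    by_cases h1 : ∃ u, ∀ z ∈ S, G.Adj w z → z = u
    · obtain ⟨u, hu⟩ := h1
      obtain ⟨f, ε, hf⟩ := ih _ hlt (S.erase w) G hG' rfl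
      -- There is at most one neighbour; `f u + 1` is a dummy second colour.
      obtain ⟨k, η, hk, -⟩ := exists_paleySign_eq (f u) (f u + 1) (by simp) (ε u * σ w u) 1
      refine extend f ε k η hf fun z hz hwz => ?_
      rw [hu z hz hwz]
      exact hk
    · push Not at h1
      -- Excluding `w` itself is no restriction; this just picks a neighbour.
      obtain ⟨u, hu, hwu, -⟩ := h1 w
      obtain ⟨v, hv, hwv, hvu⟩ := h1 u
      have hN : ∀ z ∈ S, G.Adj w z → z = u ∨ z = v := by
        intro z hz hwz
        by_contra! hne
        have : ({u, v, z} : Finset V) ⊆ S.filter (G.Adj w) := by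
          intro y hy
          simp only [Finset.mem_insert, Finset.mem_singleton] at hy
          rcases hy with rfl | rfl | rfl <;> simp [*]
        have := Finset.card_le_card this
        rw [Finset.card_eq_three.2 ⟨u, v, z, hvu.symm, hne.1.symm, hne.2.symm, rfl⟩] at this
        omega
      obtain ⟨f, ε, hf⟩ := ih _ hlt (S.erase w) (G.contract u w) (fun h => hG
        (HasK4MinorOn.of_contract hwu.symm hw (by rwa [Finset.coe_erase] at h))) rfl
      have huv : (G.contract u w).Adj u v := Or.inr (Or.inl ⟨rfl, hvu, hwv⟩)
      have hne := (hf u (Finset.mem_erase.2 ⟨hwu.ne', hu⟩) v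
        (Finset.mem_erase.2 ⟨hwv.ne', hv⟩) huv).1
      obtain ⟨k, η, hku, hkv⟩ := exists_paleySign_eq (f u) (f v) hne (ε u * σ w u) (ε v * σ w v)
      refine extend f ε k η (fun a ha b hb hab => hf a ha b hb (Or.inl hab)) fun z hz hwz => ?_
      rcases hN z hz hwz with rfl | rfl
      · exact hku
      · exact hkv

end SimpleGraph

/-! ### Switching homomorphisms to the signed Paley graph. -/

namespace SignedGraph

variable {V : Type*}

open Classical in
/-- The sign of a pair of vertices, set to `1` for non-adjacent pairs. -/
noncomputable def pairSign (S : SignedGraph V) (u v : V) : ℤˣ :=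
  if h : S.graph.Adj u v then S.sign ⟨s(u, v), h⟩ else 1

theorem pairSign_comm (S : SignedGraph V) (u v : V) : S.pairSign u v = S.pairSign v u := by
  unfold pairSign
  by_cases h : S.graph.Adj u v
  · rw [dif_pos h, dif_pos h.symm]
    congr 2
    exact Sym2.eq_swap
  · rw [dif_neg h, dif_neg fun h' => h h'.symm]

theorem posAdj_iff {S : SignedGraph V} {u v : V} :
    S.PosAdj u v ↔ S.graph.Adj u v ∧ S.pairSign u v = 1 := by
  unfold PosAdj pairSign
  constructor
  · rintro ⟨h, hs⟩
    exact ⟨h, by rw [dif_pos h, hs]⟩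
  · rintro ⟨h, hs⟩
    exact ⟨h, by rwa [dif_pos h] at hs⟩

theorem negAdj_iff {S : SignedGraph V} {u v : V} :
    S.NegAdj u v ↔ S.graph.Adj u v ∧ S.pairSign u v = -1 := by
  unfold NegAdj pairSign
  constructor
  · rintro ⟨h, hs⟩
    exact ⟨h, by rw [dif_pos h, hs]⟩
  · rintro ⟨h, hs⟩
    exact ⟨h, by rwa [dif_pos h] at hs⟩

open Classical in
theorem pairSign_switch {S : SignedGraph V} {A : Set V} {u v : V} (h : S.graph.Adj u v) :
    (S.switch A).pairSign u v =
      S.pairSign u v * ((if u ∈ A then (-1 : ℤˣ) else 1) * (if v ∈ A then (-1 : ℤˣ) else 1)) := by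
  have h' : (S.switch A).graph.Adj u v := h
  unfold pairSign
  rw [dif_pos h, dif_pos h']
  simp [switch]

theorem spal5_adj {i j : Fin 5} (hij : i ≠ j) : SPal5.graph.Adj i j := by
  revert i j
  simp only [SPal5, ofEdges, SimpleGraph.fromEdgeSet_adj, Finset.mem_coe]
  decide

theorem spal5_pairSign {i j : Fin 5} (hij : i ≠ j) : SPal5.pairSign i j = paleySign i j := by
  unfold pairSign
  rw [dif_pos (spal5_adj hij)]
  simp only [SPal5, ofEdges]
  revert i j
  decide

/-- A colouring of the vertices by the vertices of the signed Paley graph and by signs,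
compatible with the signs of the edges. -/
theorem exists_paley_coloring [Finite V] (S : SignedGraph V) (hS : S.graph.IsSeriesParallel) :
    ∃ (f : V → Fin 5) (ε : V → ℤˣ), ∀ u v, S.graph.Adj u v →
      f u ≠ f v ∧ paleySign (f u) (f v) = ε u * ε v * S.pairSign u v := by
  have := Fintype.ofFinite V
  obtain ⟨f, ε, h⟩ := SimpleGraph.exists_paley_coloring Finset.univ S.graph S.pairSign
    S.pairSign_comm (fun h => h.not_isSeriesParallel hS)
  exact ⟨f, ε, fun u v => h u (Finset.mem_univ u) v (Finset.mem_univ v)⟩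

theorem switchingHom_SPal5 [Finite V] (S : SignedGraph V) (hS : S.graph.IsSeriesParallel) :
    S.SwitchingHom SPal5 := by
  obtain ⟨f, ε, h⟩ := S.exists_paley_coloring hS
  have key : ∀ u v, S.graph.Adj u v →
      (S.switch {v | ε v = -1}).pairSign u v = SPal5.pairSign (f u) (f v) := by
    intro u v huv
    rw [pairSign_switch huv, spal5_pairSign (h u v huv).1, (h u v huv).2, mul_comm]
    congr 1
    rcases Int.units_eq_one_or (ε u) with hu | hu <;>
      rcases Int.units_eq_one_or (ε v) with hv | hv <;> simp [hu, hv]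
  refine ⟨{v | ε v = -1}, f, fun u v huv => ?_, fun u v huv => ?_⟩
  · rw [posAdj_iff] at huv ⊢
    exact ⟨spal5_adj (h u v huv.1).1, by rw [← key u v huv.1, huv.2]⟩
  · rw [negAdj_iff] at huv ⊢
    exact ⟨spal5_adj (h u v huv.1).1, by rw [← key u v huv.1, huv.2]⟩

/-! ### The upper bound: the signed Paley graph on the circle of circumference `10/3`. -/

/-- A real number at distance at least one from all multiples of the period has norm at least one. -/
theorem one_le_norm_of_mem_Icc {p x : ℝ} (h1 : 1 ≤ x) (h2 : x ≤ p - 1) :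
    1 ≤ ‖(x : AddCircle p)‖ := by
  rw [AddCircle.norm_eq, le_abs]
  set n := round (p⁻¹ * x)
  have hp : 0 < p := by linarith
  rcases le_or_gt n 0 with hn | hn
  · have : (n : ℝ) ≤ 0 := by exact_mod_cast hn
    left
    nlinarith
  · have : (1 : ℝ) ≤ n := by exact_mod_cast hn
    right
    nlinarith

/-- The position, in thirds, of the vertex `i` of the signed Paley graph on the circle of
circumference `10 / 3`; it is moved to the antipodal point if `s = -1`. -/
def paleyPosition (i : Fin 5) (s : ℤˣ) : ℤ := 2 * (i : ℕ) + if s = 1 then 0 else 5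

/-- In thirds the circumference is 10, the antipodal shift is 5, and distance at least 1 means a
residue from 3 to 7. Nonconsecutive Paley vertices differ by 4 or 6; consecutive ones differ by 2 or
8, which the shift turns into 7 or 3. -/
theorem paleyPosition_pos (i j : Fin 5) (hij : i ≠ j) (s t : ℤˣ) (h : paleySign i j = s * t * 1) :
    3 ≤ (paleyPosition i s - paleyPosition j t) % 10 ∧
      (paleyPosition i s - paleyPosition j t) % 10 ≤ 7 := by
  revert i j s t
  decide

theorem paleyPosition_neg (i j : Fin 5) (hij : i ≠ j) (s t : ℤˣ) (h : paleySign i j = s * t * -1) :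
    3 ≤ (paleyPosition i s - paleyPosition j t - 5) % 10 ∧
      (paleyPosition i s - paleyPosition j t - 5) % 10 ≤ 7 := by
  revert i j s t
  decide

theorem one_le_norm_of_third {n : ℤ} (h : 3 ≤ n % 10 ∧ n % 10 ≤ 7) :
    1 ≤ ‖(((n : ℝ) / 3 : ℝ) : AddCircle (10 / 3 : ℝ))‖ := by
  have hn : (n : ℝ) = (n % 10 : ℤ) + 10 * (n / 10 : ℤ) := by
    exact_mod_cast (Int.emod_add_mul_ediv n 10).symm
  have : (((n : ℝ) / 3 : ℝ) : AddCircle (10 / 3 : ℝ)) = ((((n % 10 : ℤ) : ℝ) / 3 : ℝ) :) := by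
    rw [← sub_eq_zero, ← AddCircle.coe_sub, AddCircle.coe_eq_zero_iff]
    refine ⟨n / 10, ?_⟩
    rw [zsmul_eq_mul]
    linarith
  rw [this]
  have h1 : (3 : ℝ) ≤ (n % 10 : ℤ) := by exact_mod_cast h.1
  have h2 : ((n % 10 : ℤ) : ℝ) ≤ 7 := by exact_mod_cast h.2
  exact one_le_norm_of_mem_Icc (by linarith) (by linarith)

theorem circularColorable_of_isSeriesParallel [Finite V] (S : SignedGraph V)
    (hS : S.graph.IsSeriesParallel) : S.CircularColorable (10 / 3) := by
  obtain ⟨f, ε, h⟩ := S.exists_paley_coloring hS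
  refine ⟨fun v => (((paleyPosition (f v) (ε v) : ℤ) : ℝ) / 3 : ℝ), fun u v huv => ?_,
    fun u v huv => ?_⟩
  · rw [posAdj_iff] at huv
    obtain ⟨hne, hs⟩ := h u v huv.1
    rw [huv.2] at hs
    have := one_le_norm_of_third (paleyPosition_pos _ _ hne _ _ hs)
    rw [dist_eq_norm, ← AddCircle.coe_sub]
    push_cast at this
    rwa [← sub_div]
  · rw [negAdj_iff] at huv
    obtain ⟨hne, hs⟩ := h u v huv.1
    rw [huv.2] at hs
    have := one_le_norm_of_third (paleyPosition_neg _ _ hne _ _ hs)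
    rw [dist_eq_norm, ← AddCircle.coe_add, ← AddCircle.coe_sub]
    push_cast at this
    have heq : ∀ a b : ℝ, a / 3 - (b / 3 + 10 / 3 / 2) = (a - b - 5) / 3 := fun a b => by ring
    rwa [heq]

theorem circularChromaticNumber_le {S : SignedGraph V} {r : ℝ} (hr : 1 ≤ r)
    (h : S.CircularColorable r) : S.circularChromaticNumber ≤ r :=
  csInf_le ⟨1, fun _ hx => hx.1⟩ ⟨hr, h⟩

end SignedGraph

/-! ### The lower bound: circular colourings of `F`. -/

theorem AddCircle.exists_coe_eq_abs_le {r : ℝ} (hr : 0 < r) (a : AddCircle r) :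
    ∃ x : ℝ, (x : AddCircle r) = a ∧ |x| ≤ r / 2 ∧ ‖a‖ = |x| := by
  have := Fact.mk hr
  obtain ⟨x, hx, rfl⟩ := (AddCircle.coe_image_Ico_eq r (-(r / 2))).symm ▸ Set.mem_univ a
  have h : |x| ≤ r / 2 := abs_le.2 ⟨hx.1, by linarith [hx.2]⟩
  exact ⟨x, rfl, h, (AddCircle.norm_coe_eq_abs_iff r hr.ne').2 (by rwa [abs_of_pos hr])⟩

/-- The distances of a point to a point and to its antipode add up to half the circumference. -/
theorem AddCircle.dist_add_dist_antipode {r : ℝ} (hr : 0 < r) (a b : AddCircle r) :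
    dist a b + dist a (b + ((r / 2 : ℝ) : AddCircle r)) = r / 2 := by
  obtain ⟨x, hx, hxr, hn⟩ := AddCircle.exists_coe_eq_abs_le hr (a - b)
  have hnorm : ∀ y : ℝ, |y| ≤ r / 2 → ‖(y : AddCircle r)‖ = |y| := fun y hy =>
    (AddCircle.norm_coe_eq_abs_iff r hr.ne').2 (by rwa [abs_of_pos hr])
  rw [dist_eq_norm, dist_eq_norm, hn, ← sub_sub, ← hx, ← AddCircle.coe_sub]
  rw [abs_le] at hxr
  rcases le_or_gt 0 x with h0 | h0
  · rw [hnorm _ (abs_le.2 ⟨by linarith, by linarith⟩), abs_of_nonneg h0,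
      abs_of_nonpos (by linarith)]
    ring
  · rw [← AddCircle.coe_add_period, hnorm _ (abs_le.2 ⟨by linarith, by linarith⟩), abs_of_neg h0,
      abs_of_nonneg (by linarith)]
    ring

/-- Three points on a circle whose pairwise distances are at most `r / 2 - 1` and at least
`2 - r / 2` exist only if the circumference is at least `10 / 3`. -/
theorem AddCircle.ten_thirds_le_of_dist {r : ℝ} (hr : 0 < r) (x y z : AddCircle r)
    (hxy : dist x y ≤ r / 2 - 1) (hyz : dist y z ≤ r / 2 - 1) (hxz : dist x z ≤ r / 2 - 1)
    (hxy' : 2 - r / 2 ≤ dist x y) (hyz' : 2 - r / 2 ≤ dist y z) (hxz' : 2 - r / 2 ≤ dist x z) :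
    10 / 3 ≤ r := by
  by_contra! hlt
  obtain ⟨s, hs, -, hsn⟩ := AddCircle.exists_coe_eq_abs_le hr (x - y)
  obtain ⟨t, ht, -, htn⟩ := AddCircle.exists_coe_eq_abs_le hr (y - z)
  rw [dist_eq_norm] at hxy hxy' hyz hyz' hxz hxz'
  rw [hsn] at hxy hxy'
  rw [htn] at hyz hyz'
  -- Since `|s| + |t| ≤ r - 2 ≤ r / 2`, the sum does not wrap around the circle.
  have hst : |s + t| ≤ r / 2 := (abs_add_le s t).trans (by linarith)
  have hxzn : ‖x - z‖ = |s + t| := by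
    rw [← sub_add_sub_cancel x y z, ← hs, ← ht, ← AddCircle.coe_add]
    exact (AddCircle.norm_coe_eq_abs_iff r hr.ne').2 (by rwa [abs_of_pos hr])
  rw [hxzn] at hxz hxz'
  -- With equal signs `|s + t| ≥ 4 - r > r/2 - 1`; with opposite signs `|s + t| ≤ r - 3 < 2 - r/2`.
  -- Both strict inequalities say `r < 10/3`.
  rcases abs_cases s with h1 | h1 <;> rcases abs_cases t with h2 | h2 <;>
    rcases abs_cases (s + t) with h3 | h3 <;> linarith

namespace SignedGraph

theorem F_posAdj {u v : Fin 6}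
    (h : s(u, v) ∈ ({s(1, 4), s(0, 3), s(2, 5)} : Finset (Sym2 (Fin 6)))) : F.PosAdj u v := by
  have : u ≠ v ∧ s(u, v) ∉ ({s(0, 1), s(1, 2), s(0, 2), s(1, 5), s(0, 4), s(2, 3)} :
      Finset (Sym2 (Fin 6))) := by
    revert u v
    decide
  exact ⟨(SimpleGraph.fromEdgeSet_adj _).2 ⟨Finset.mem_union_left _ h, this.1⟩, if_neg this.2⟩

theorem F_negAdj {u v : Fin 6}
    (h : s(u, v) ∈ ({s(0, 1), s(1, 2), s(0, 2), s(1, 5), s(0, 4), s(2, 3)} :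
      Finset (Sym2 (Fin 6)))) : F.NegAdj u v := by
  have : u ≠ v := by
    revert u v
    decide
  exact ⟨(SimpleGraph.fromEdgeSet_adj _).2 ⟨Finset.mem_union_right _ h, this⟩, if_pos h⟩

theorem ten_thirds_le_of_F_circularColorable {r : ℝ} (hr : 0 < r) (h : F.CircularColorable r) :
    10 / 3 ≤ r := by
  obtain ⟨f, hpos, hneg⟩ := h
  have neg : ∀ u v, F.NegAdj u v → dist (f u) (f v) ≤ r / 2 - 1 := fun u v huv => by
    have := AddCircle.dist_add_dist_antipode hr (f u) (f v)
    have := hneg u v huv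
    linarith
  have far : ∀ u v w, F.NegAdj u w → F.PosAdj v w → 2 - r / 2 ≤ dist (f u) (f v) :=
    fun u v w huw hvw => by
      have h1 := neg u w huw
      have h2 := hpos v w hvw
      have h3 := dist_triangle (f v) (f u) (f w)
      rw [dist_comm (f v) (f u)] at h3
      linarith
  have hzx := far 2 0 3 (F_negAdj (by decide)) (F_posAdj (by decide))
  rw [dist_comm] at hzx
  have hzy := far 1 2 5 (F_negAdj (by decide)) (F_posAdj (by decide))
  exact AddCircle.ten_thirds_le_of_dist hr (f 0) (f 1) (f 2)
    (neg 0 1 (F_negAdj (by decide))) (neg 1 2 (F_negAdj (by decide)))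
    (neg 0 2 (F_negAdj (by decide)))
    (far 0 1 4 (F_negAdj (by decide)) (F_posAdj (by decide))) hzy hzx

end SignedGraph

/-! ### Arcs in the disc with interleaved ends. -/

open unitInterval in
/-- A nowhere vanishing continuous function on the unit square has a continuous argument. -/
theorem exists_continuous_arg_on_square (H : I × I → ℂ) (hH : Continuous H) (h0 : ∀ z, H z ≠ 0) :
    ∃ θ : I × I → ℝ, Continuous θ ∧
      ∀ z, H z = (‖H z‖ : ℂ) * Complex.exp (θ z * Complex.I) := by
  -- Clamping extends `H` to the plane, where it lifts through the covering map `exp`; the imaginary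
  -- part of the lift is the argument.
  let π : ℝ → I := Set.projIcc 0 1 zero_le_one
  have hπ : Continuous π := continuous_projIcc
  obtain ⟨L, ⟨-, hL⟩, -⟩ := Complex.isCoveringMapOn_exp.existsUnique_continuousMap_lifts
    (⟨fun z => H (π z.1, π z.2), by fun_prop⟩ : C(ℝ × ℝ, ℂ)) (a₀ := (0, 0))
    (Complex.exp_log (h0 (π 0, π 0))) (fun z => h0 (π z.1, π z.2))
  refine ⟨fun z => (L (z.1, z.2)).im, by fun_prop, fun z => ?_⟩
  have hz : Complex.exp (L (z.1, z.2)) = H z := by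
    have := congrFun hL (z.1, z.2)
    simpa [π] using this
  rw [← hz, Complex.norm_exp, Complex.ofReal_exp, ← Complex.exp_add, Complex.re_add_im]

theorem Complex.exists_int_of_mul_exp_eq {r s x y : ℝ} (hr : 0 < r) (hs : 0 < s)
    (h : (r : ℂ) * exp (x * I) = s * exp (y * I)) : ∃ k : ℤ, x = y + k * (2 * Real.pi) := by
  have hrs : r = s := by
    have := congrArg norm h
    rwa [norm_mul, norm_mul, norm_exp_ofReal_mul_I, norm_exp_ofReal_mul_I, norm_real, norm_real,
      mul_one, mul_one, Real.norm_of_nonneg hr.le, Real.norm_of_nonneg hs.le] at this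
  rw [hrs] at h
  have h' := mul_left_cancel₀ (by exact_mod_cast hs.ne') h
  obtain ⟨k, hk⟩ := exp_eq_exp_iff_exists_int.1 h'
  refine ⟨k, ?_⟩
  have := congrArg im hk
  simpa using this

/-- The direction of a chord of the unit circle. -/
theorem Complex.exp_sub_exp_eq_mul (x y : ℝ) :
    exp (x * I) - exp (y * I) =
      ((2 * Real.sin ((y - x) / 2) : ℝ) : ℂ) * exp (((x + y) / 2 - Real.pi / 2 : ℝ) * I) := by
  have hx : exp (x * I) = exp (((x + y) / 2 : ℝ) * I) * exp (-((y - x) / 2 : ℝ) * I) := by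
    rw [← exp_add]
    congr 1
    push_cast
    ring
  have hy : exp (y * I) = exp (((x + y) / 2 : ℝ) * I) * exp (((y - x) / 2 : ℝ) * I) := by
    rw [← exp_add]
    congr 1
    push_cast
    ring
  have hpi : exp (((x + y) / 2 - Real.pi / 2 : ℝ) * I) = exp (((x + y) / 2 : ℝ) * I) * -I := by
    have : (((x + y) / 2 - Real.pi / 2 : ℝ) : ℂ) * I =
        ((x + y) / 2 : ℝ) * I + -(Real.pi / 2 * I) := by
      push_cast
      ring
    rw [this, exp_add, exp_neg, exp_pi_div_two_mul_I, inv_I]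
  rw [hx, hy, hpi, ofReal_mul, ofReal_sin, exp_mul_I, exp_mul_I (_ : ℂ), exp_mul_I (_ : ℂ),
    cos_neg, sin_neg]
  push_cast
  ring

theorem Complex.re_lt_one_of_norm_le_one {w : ℂ} (hw : ‖w‖ ≤ 1) (h : w ≠ 1) : w.re < 1 := by
  refine lt_of_le_of_ne ((re_le_norm w).trans hw) fun hre => h ?_
  have h1 : w.re * w.re + w.im * w.im ≤ 1 := by
    rw [← normSq_apply, normSq_eq_norm_sq]
    nlinarith [norm_nonneg w]
  rw [hre] at h1
  have him : w.im = 0 := by nlinarith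
  exact Complex.ext (by simpa using hre) (by simpa using him)

open unitInterval in
/-- Change of the direction from a point of the unit circle to a point that moves in the disc. -/
theorem arg_change_from_circle_point {φ β β' : ℝ} (hβ : φ < β ∧ β < φ + 2 * Real.pi)
    (hβ' : φ < β' ∧ β' < φ + 2 * Real.pi) (w : I → ℂ) (hw : ∀ t, ‖w t‖ ≤ 1)
    (hne : ∀ t, w t ≠ Complex.exp (φ * Complex.I)) (θ : I → ℝ) (hθ : Continuous θ) (ρ : I → ℝ)
    (hρ : ∀ t, 0 < ρ t)
    (h : ∀ t, Complex.exp (φ * Complex.I) - w t = ρ t * Complex.exp (θ t * Complex.I))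
    (h0 : w 0 = Complex.exp (β * Complex.I)) (h1 : w 1 = Complex.exp (β' * Complex.I)) :
    θ 1 - θ 0 = (β' - β) / 2 := by
  -- A point of the disc other than `exp (φ * I)` lies strictly on the inner side of the tangent
  -- there, so the difference has positive component in direction `φ`.
  have hcos : ∀ t, Real.cos (θ t - φ) ≠ 0 := by
    intro t hc
    have hmul : Complex.exp (-φ * Complex.I) * Complex.exp (φ * Complex.I) = 1 := by
      rw [← Complex.exp_add]
      simp
    have hlt := Complex.re_lt_one_of_norm_le_one (w := Complex.exp (-φ * Complex.I) * w t)
      (by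
        rw [norm_mul, ← Complex.ofReal_neg, Complex.norm_exp_ofReal_mul_I, one_mul]
        exact hw t)
      (fun h' => hne t (mul_left_cancel₀ (Complex.exp_ne_zero _) (h'.trans hmul.symm)))
    have hre := congrArg Complex.re (congrArg (Complex.exp (-φ * Complex.I) * ·) (h t))
    have hrhs : Complex.exp (-φ * Complex.I) * (ρ t * Complex.exp (θ t * Complex.I)) =
        ρ t * Complex.exp ((θ t - φ : ℝ) * Complex.I) := by
      rw [mul_left_comm, ← Complex.exp_add]
      congr 2
      push_cast
      ring
    simp only [mul_sub, hmul, hrhs] at hre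
    rw [Complex.re_ofReal_mul, Complex.exp_ofReal_mul_I_re, hc] at hre
    simp only [Complex.sub_re, Complex.one_re] at hre
    linarith
  have hpi := Real.pi_pos
  have hcorner : ∀ t b, φ < b ∧ b < φ + 2 * Real.pi → w t = Complex.exp (b * Complex.I) →
      ∃ k : ℤ, θ t = (φ + b) / 2 - Real.pi / 2 + k * (2 * Real.pi) := by
    intro t b hb hwt
    have ht := h t
    rw [hwt, Complex.exp_sub_exp_eq_mul] at ht
    refine Complex.exists_int_of_mul_exp_eq (hρ t) ?_ ht.symm
    exact mul_pos two_pos (Real.sin_pos_of_pos_of_lt_pi (by linarith) (by linarith))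
  obtain ⟨k, hk⟩ := hcorner 0 β hβ h0
  obtain ⟨m, hm⟩ := hcorner 1 β' hβ' h1
  -- These barriers separate the branches `k` and `m` of the two end values, so by the intermediate
  -- value theorem the branches coincide.
  have hzero : ∀ j : ℤ, ∀ t, θ t ≠ φ + Real.pi / 2 + j * (2 * Real.pi) := by
    intro j t ht
    apply hcos t
    rw [ht, show φ + Real.pi / 2 + j * (2 * Real.pi) - φ = Real.pi / 2 + j * (2 * Real.pi) by ring,
      Real.cos_add_int_mul_two_pi, Real.cos_pi_div_two]
  have hkm : k = m := by
    rcases lt_trichotomy k m with hlt | heq | hlt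
    · have hlt' : (k : ℝ) + 1 ≤ m := by exact_mod_cast hlt
      obtain ⟨t, ht⟩ := mem_range_of_exists_le_of_exists_ge hθ
        (c := φ + Real.pi / 2 + k * (2 * Real.pi))
        ⟨0, by rw [hk]; linarith⟩ ⟨1, by rw [hm]; nlinarith⟩
      exact absurd ht (hzero k t)
    · exact heq
    · have hlt' : (m : ℝ) + 1 ≤ k := by exact_mod_cast hlt
      obtain ⟨t, ht⟩ := mem_range_of_exists_le_of_exists_ge hθ
        (c := φ + Real.pi / 2 + m * (2 * Real.pi))
        ⟨1, by rw [hm]; linarith⟩ ⟨0, by rw [hk]; nlinarith⟩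
      exact absurd ht (hzero m t)
  rw [hk, hm, hkm]
  ring

open unitInterval in
/-- Two arcs in the closed unit disc whose ends interleave on the boundary circle meet. -/
theorem exists_eq_of_interleaved_ends {α β γ δ : ℝ} (h1 : α < γ) (h2 : γ < β) (h3 : β < δ)
    (h4 : δ < α + 2 * Real.pi) (p q : C(I, ℂ)) (hp : ∀ t, ‖p t‖ ≤ 1) (hq : ∀ t, ‖q t‖ ≤ 1)
    (hp0 : p 0 = Complex.exp (α * Complex.I)) (hp1 : p 1 = Complex.exp (β * Complex.I))
    (hq0 : q 0 = Complex.exp (γ * Complex.I)) (hq1 : q 1 = Complex.exp (δ * Complex.I)) :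
    ∃ s t, p s = q t := by
  by_contra! hpq
  have hexp : ∀ x : ℝ, Complex.exp ((x + 2 * Real.pi : ℝ) * Complex.I) =
      Complex.exp (x * Complex.I) := by
    intro x
    push_cast
    rw [add_mul]
    exact Complex.exp_periodic _
  have hpi := Real.pi_pos
  -- A continuous argument of `p - q` has total change zero around the square. On each side one of
  -- the two points is a fixed circle point, so the change is known, and the four changes add up to
  -- a full turn instead.
  obtain ⟨θ, hθ, hH⟩ := exists_continuous_arg_on_square (fun z => p z.1 - q z.2) (by fun_prop)
    (fun z => sub_ne_zero.2 (hpq z.1 z.2))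
  have hρ : ∀ s t, 0 < ‖p s - q t‖ := fun s t => norm_pos_iff.2 (sub_ne_zero.2 (hpq s t))
  have hH' : ∀ s t, q t - p s = (‖p s - q t‖ : ℂ) *
      Complex.exp ((θ (s, t) + Real.pi : ℝ) * Complex.I) := by
    intro s t
    have := hH (s, t)
    dsimp only at this
    rw [Complex.ofReal_add, add_mul, Complex.exp_add, Complex.exp_pi_mul_I, ← mul_assoc, ← this]
    ring
  have e1 := arg_change_from_circle_point (φ := α) (β := γ) (β' := δ) ⟨by linarith, by linarith⟩
    ⟨by linarith, by linarith⟩ q hq (fun t => hp0 ▸ (hpq 0 t).symm) (fun t => θ (0, t))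
    (by fun_prop) (fun t => ‖p 0 - q t‖) (hρ 0) (fun t => hp0 ▸ hH (0, t)) hq0 hq1
  -- Angles are raised by `2π` where needed to lie in the turn that starts at the fixed point;
  -- raising only one of the two ends, here and in `e3`, produces the surplus.
  have e2 := arg_change_from_circle_point (φ := β) (β := γ + 2 * Real.pi) (β' := δ)
    ⟨by linarith, by linarith⟩
    ⟨by linarith, by linarith⟩ q hq (fun t => hp1 ▸ (hpq 1 t).symm) (fun t => θ (1, t))
    (by fun_prop) (fun t => ‖p 1 - q t‖) (hρ 1) (fun t => hp1 ▸ hH (1, t))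
    (hq0.trans (hexp γ).symm) hq1
  have e3 := arg_change_from_circle_point (φ := γ) (β := α + 2 * Real.pi) (β' := β)
    ⟨by linarith, by linarith⟩
    ⟨by linarith, by linarith⟩ p hp (fun s => hq0 ▸ hpq s 0) (fun s => θ (s, 0) + Real.pi)
    (by fun_prop) (fun s => ‖p s - q 0‖) (fun s => hρ s 0) (fun s => hq0 ▸ hH' s 0)
    (hp0.trans (hexp α).symm) hp1
  have e4 := arg_change_from_circle_point (φ := δ) (β := α + 2 * Real.pi) (β' := β + 2 * Real.pi)
    ⟨by linarith, by linarith⟩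
    ⟨by linarith, by linarith⟩ p hp (fun s => hq1 ▸ hpq s 1) (fun s => θ (s, 1) + Real.pi)
    (by fun_prop) (fun s => ‖p s - q 1‖) (fun s => hρ s 1) (fun s => hq1 ▸ hH' s 1)
    (hp0.trans (hexp α).symm) (hp1.trans (hexp β).symm)
  linarith

/-! ### Interleaving pairs on a line and `K₄` minors. -/

/-- `a` lies strictly between `x` and `y`. -/
def StrictlyBetween (a x y : ℝ) : Prop := (x < a ∧ a < y) ∨ (y < a ∧ a < x)

/-- Of the three pairings of four real numbers, one is interleaved. -/
theorem exists_interleaved_pairing {a b c d : ℝ} (hab : a ≠ b) (hac : a ≠ c) (had : a ≠ d)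
    (hbc : b ≠ c) (hbd : b ≠ d) (hcd : c ≠ d) :
    (StrictlyBetween a b c ∧ ¬ StrictlyBetween d b c) ∨
    (StrictlyBetween b a c ∧ ¬ StrictlyBetween d a c) ∨
    (StrictlyBetween c a b ∧ ¬ StrictlyBetween d a b) ∨
    (StrictlyBetween d a b ∧ ¬ StrictlyBetween c a b) ∨
    (StrictlyBetween d a c ∧ ¬ StrictlyBetween b a c) ∨
    (StrictlyBetween d b c ∧ ¬ StrictlyBetween a b c) := by
  unfold StrictlyBetween
  grind

/-- Interleaving is a symmetric relation of pairs. -/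
theorem strictlyBetween_swap {a b x y : ℝ} (hay : a ≠ y) (hby : b ≠ y) (h1 : StrictlyBetween x a b) (h2 : ¬ StrictlyBetween y a b) :
    (StrictlyBetween a x y ∧ ¬ StrictlyBetween b x y) ∨
      (StrictlyBetween b x y ∧ ¬ StrictlyBetween a x y) := by
  unfold StrictlyBetween at *
  grind

namespace SimpleGraph

variable {V : Type*} {G : SimpleGraph V}

/-- If no two edges interleave on a line, then no two disjoint connected vertex sets do. -/
theorem not_interleaved_of_connected {p : V → ℝ} (hp : Function.Injective p)
    (hG : ∀ u v a b, G.Adj u v → G.Adj a b → ¬ (p u < p a ∧ p a < p v ∧ p v < p b))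
    {A B : Set V} (hA : (G.induce A).Connected) (hB : (G.induce B).Connected)
    (hAB : Disjoint A B) {a a' b b' : V} (ha : a ∈ A) (ha' : a' ∈ A) (hb : b ∈ B) (hb' : b' ∈ B)
    (h1 : StrictlyBetween (p b) (p a) (p a')) (h2 : ¬ StrictlyBetween (p b') (p a) (p a')) :
    False := by
  have ne : ∀ u ∈ A, ∀ v ∈ B, p u ≠ p v := fun u hu v hv h =>
    Set.disjoint_left.1 hAB hu (hp h ▸ hv)
  have edge : ∀ u v x y, G.Adj u v → G.Adj x y → p x ≠ p u → p x ≠ p v → p y ≠ p u → p y ≠ p v →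
      StrictlyBetween (p x) (p u) (p v) → ¬ StrictlyBetween (p y) (p u) (p v) → False := by
    intro u v x y huv hxy n1 n2 n3 n4 hx hy
    have g1 := hG u v x y huv hxy
    have g2 := hG v u x y huv.symm hxy
    have g3 := hG y x u v hxy.symm huv
    have g4 := hG y x v u hxy.symm huv.symm
    unfold StrictlyBetween at hx hy
    grind
  -- Some edge `uv` of `B` interleaves with the pair `a, a'`. Seen from `uv`, the connected set `A`
  -- has points inside and outside, hence an edge that interleaves with `uv`.
  obtain ⟨u, hu, v, hv, hut, hvt, huv⟩ := exists_adj_of_connected_induce hB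
    {w | StrictlyBetween (p w) (p a) (p a')} hb h1 hb' h2
  have cross : ∀ x ∈ A, ∀ y ∈ A, StrictlyBetween (p x) (p u) (p v) →
      ¬ StrictlyBetween (p y) (p u) (p v) → False := by
    intro x hx y hy hxt hyt
    obtain ⟨w, hw, z, hz, hwt, hzt, hwz⟩ := exists_adj_of_connected_induce hA
      {w | StrictlyBetween (p w) (p u) (p v)} hx hxt hy hyt
    exact edge u v w z huv hwz (ne w hw u hu) (ne w hw v hv) (ne z hz u hu) (ne z hz v hv) hwt hzt
  rcases strictlyBetween_swap (ne a ha v hv) (ne a' ha' v hv) hut hvt with h | h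
  · exact cross a ha a' ha' h.1 h.2
  · exact cross a' ha' a ha h.1 h.2

/-- A graph whose vertices lie on a line such that no two edges interleave has no `K₄` minor. -/
theorem isSeriesParallel_of_not_interleaved {p : V → ℝ} (hp : Function.Injective p)
    (hG : ∀ u v a b, G.Adj u v → G.Adj a b → ¬ (p u < p a ∧ p a < p v ∧ p v < p b)) :
    G.IsSeriesParallel := by
  rintro ⟨B, hc, hd, hadj⟩
  -- Each pairing of the four branch sets gives two disjoint connected sets, and one pairing of
  -- their representatives is interleaved.
  have hpair : ∀ i j, i ≠ j → (G.induce (B i ∪ B j)).Connected := fun i j hij => by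
    obtain ⟨u, hu, v, hv, huv⟩ := hadj i j hij
    exact connected_induce_union (hc i).preconnected (hc j).preconnected hu hv huv
  have hx : ∀ i, ∃ x, x ∈ B i := fun i => by
    obtain ⟨⟨x, hx⟩⟩ := (hc i).nonempty
    exact ⟨x, hx⟩
  choose x hx using hx
  have hne : ∀ i j, i ≠ j → p (x i) ≠ p (x j) := fun i j hij h =>
    Set.disjoint_left.1 (hd i j hij) (hx i) (hp h ▸ hx j)
  have key : ∀ i j k l : Fin 4, i ≠ j → k ≠ l → i ≠ k → i ≠ l → j ≠ k → j ≠ l →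
      StrictlyBetween (p (x k)) (p (x i)) (p (x j)) →
      ¬ StrictlyBetween (p (x l)) (p (x i)) (p (x j)) → False := by
    intro i j k l hij hkl hik hil hjk hjl h1 h2
    refine not_interleaved_of_connected hp hG (hpair i j hij) (hpair k l hkl) ?_ (Or.inl (hx i))
      (Or.inr (hx j)) (Or.inl (hx k)) (Or.inr (hx l)) h1 h2
    simp [hd i k hik, hd i l hil, hd j k hjk, hd j l hjl]
  rcases exists_interleaved_pairing (hne 0 1 (by decide)) (hne 0 2 (by decide))
    (hne 0 3 (by decide)) (hne 1 2 (by decide)) (hne 1 3 (by decide)) (hne 2 3 (by decide))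
    with h | h | h | h | h | h
  · exact key 1 2 0 3 (by decide) (by decide) (by decide) (by decide) (by decide) (by decide) h.1 h.2
  · exact key 0 2 1 3 (by decide) (by decide) (by decide) (by decide) (by decide) (by decide) h.1 h.2
  · exact key 0 1 2 3 (by decide) (by decide) (by decide) (by decide) (by decide) (by decide) h.1 h.2
  · exact key 0 1 3 2 (by decide) (by decide) (by decide) (by decide) (by decide) (by decide) h.1 h.2
  · exact key 0 2 3 1 (by decide) (by decide) (by decide) (by decide) (by decide) (by decide) h.1 h.2
  · exact key 1 2 3 0 (by decide) (by decide) (by decide) (by decide) (by decide) (by decide) h.1 h.2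

end SimpleGraph

/-! ### Outerplanar graphs: no `K₄` minor, and a criterion for straight drawings. -/

namespace SimpleGraph

variable {V : Type*} {G : SimpleGraph V}

open unitInterval in
/-- The two orientations of an arc. -/
theorem exists_oriented_arc {x y : ℂ} (c : C(I, ℂ)) (h : s(c 0, c 1) = s(x, y)) :
    ∃ d : C(I, ℂ), d 0 = x ∧ d 1 = y ∧ ∀ t, ∃ t', d t = c t' := by
  rcases Sym2.eq_iff.1 h with ⟨h0, h1⟩ | ⟨h0, h1⟩
  · exact ⟨c, h0, h1, fun t => ⟨t, rfl⟩⟩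
  · refine ⟨c.comp ⟨unitInterval.symm, unitInterval.continuous_symm⟩, ?_, ?_, fun t => ⟨σ t, rfl⟩⟩
    · simpa using h1
    · simpa using h0

-- Cutting the circle open by the argument puts the vertices on a line. Interleaved edges would have
-- arcs that meet, and four distinct ends leave no permitted meeting point.
open unitInterval in
theorem IsOuterplanar.isSeriesParallel (h : G.IsOuterplanar) : G.IsSeriesParallel := by
  obtain ⟨p, γ, hp, hsph, -, hball, hends, hinner, hcross⟩ := h
  have hexp : ∀ v, p v = Complex.exp ((p v).arg * Complex.I) := fun v => by
    have := Complex.norm_mul_exp_arg_mul_I (p v)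
    rw [mem_sphere_zero_iff_norm.1 (hsph v)] at this
    simpa using this.symm
  have hinj : Function.Injective fun v => (p v).arg := fun u v huv => hp (by
    rw [hexp u, hexp v]
    exact congrArg (fun x : ℝ => Complex.exp (x * Complex.I)) huv)
  refine isSeriesParallel_of_not_interleaved hinj fun u v a b huv hab hlt => ?_
  set e : G.edgeSet := ⟨s(u, v), huv⟩ with he
  set e' : G.edgeSet := ⟨s(a, b), hab⟩ with he'
  have hne : ∀ x y, (p x).arg < (p y).arg → p x ≠ p y := fun x y hxy h => hxy.ne (by rw [h])
  have hua := hne u a hlt.1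
  have hav := hne a v hlt.2.1
  have hvb := hne v b hlt.2.2
  have hub := hne u b (by linarith)
  have hee : e ≠ e' := by
    intro h
    have h1 : u ∈ (e' : Sym2 V) := h ▸ Sym2.mem_mk_left u v
    rcases Sym2.mem_iff.1 h1 with h2 | h2
    · exact hua (by rw [h2])
    · exact hub (by rw [h2])
  obtain ⟨c, hc0, hc1, hc⟩ := exists_oriented_arc (γ e) (hends e)
  obtain ⟨d, hd0, hd1, hd⟩ := exists_oriented_arc (γ e') (hends e')
  have hcn : ∀ t, ‖c t‖ ≤ 1 := fun t => by
    obtain ⟨t', ht'⟩ := hc t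
    rw [ht']
    exact mem_closedBall_zero_iff.1 (hball e t')
  have hdn : ∀ t, ‖d t‖ ≤ 1 := fun t => by
    obtain ⟨t', ht'⟩ := hd t
    rw [ht']
    exact mem_closedBall_zero_iff.1 (hball e' t')
  obtain ⟨s, t, hst⟩ := exists_eq_of_interleaved_ends hlt.1 hlt.2.1 hlt.2.2
    (by linarith [Complex.neg_pi_lt_arg (p u), Complex.arg_le_pi (p b)]) c d hcn hdn
    (hc0.trans (hexp u)) (hc1.trans (hexp v)) (hd0.trans (hexp a)) (hd1.trans (hexp b))
  obtain ⟨s', hs'⟩ := hc s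
  obtain ⟨t', ht'⟩ := hd t
  have hst' : γ e s' = γ e' t' := by rw [← hs', ← ht', hst]
  -- a point of an arc is an inner point or an end
  have hpt : ∀ (f : G.edgeSet) (x y : V), (f : Sym2 V) = s(x, y) → ∀ t : I,
      t ∈ Set.Ioo (0 : I) 1 ∨ γ f t = p x ∨ γ f t = p y := by
    intro f x y hf t
    have hfe := hends f
    rw [hf, Sym2.map_mk, Sym2.eq_iff] at hfe
    rcases eq_or_ne t 0 with rfl | h0
    · rcases hfe with h | h
      · exact Or.inr (Or.inl h.1)
      · exact Or.inr (Or.inr h.1)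
    · rcases eq_or_ne t 1 with rfl | h1
      · rcases hfe with h | h
        · exact Or.inr (Or.inr h.2)
        · exact Or.inr (Or.inl h.2)
      · exact Or.inl ⟨unitInterval.pos_iff_ne_zero.2 h0, unitInterval.lt_one_iff_ne_one.2 h1⟩
  rcases hpt e u v rfl s' with hs | hs
  · rcases hpt e' a b rfl t' with ht | ht
    · exact hcross e e' hee s' hs t' ht hst'
    · refine hinner e s' hs ?_
      rw [hst']
      rcases ht with ht | ht
      · exact ⟨a, ht.symm⟩
      · exact ⟨b, ht.symm⟩
  · rcases hpt e' a b rfl t' with ht | ht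
    · refine hinner e' t' ht ?_
      rw [← hst']
      rcases hs with hs | hs
      · exact ⟨u, hs.symm⟩
      · exact ⟨v, hs.symm⟩
    · rcases hs with hs | hs <;> rcases ht with ht | ht <;> rw [hst', ht] at hs
      · exact hua hs.symm
      · exact hub hs.symm
      · exact hav hs
      · exact hvb hs.symm

/-- Twice the signed area of the triangle with vertices `a`, `b`, `c`. -/
def signedArea {R : Type*} [CommRing R] (a b c : R × R) : R :=
  (b.1 - a.1) * (c.2 - a.2) - (b.2 - a.2) * (c.1 - a.1)

/-- A graph is outerplanar if it can be drawn with straight edges and vertices on a circle,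
such that of any two edges one lies on one side of the other. -/
theorem isOuterplanar_of_signedArea (q : V → ℝ × ℝ) (hq : Function.Injective q)
    (hcirc : ∀ v, (q v).1 ^ 2 + (q v).2 ^ 2 = 1)
    (hside : ∀ u v a b, G.Adj u v → G.Adj a b → s(u, v) ≠ s(a, b) →
      (0 ≤ signedArea (q u) (q v) (q a) ∧ 0 ≤ signedArea (q u) (q v) (q b) ∧
        0 < signedArea (q u) (q v) (q a) + signedArea (q u) (q v) (q b)) ∨
      (signedArea (q u) (q v) (q a) ≤ 0 ∧ signedArea (q u) (q v) (q b) ≤ 0 ∧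
        signedArea (q u) (q v) (q a) + signedArea (q u) (q v) (q b) < 0)) :
    G.IsOuterplanar := by
  set p : V → ℂ := fun v => ⟨(q v).1, (q v).2⟩ with hpdef
  have hp : Function.Injective p := fun u v h =>
    hq (Prod.ext (congrArg Complex.re h) (congrArg Complex.im h))
  have hpn : ∀ v, ‖p v‖ = 1 := fun v => by
    have h : ‖p v‖ ^ 2 = 1 := by
      rw [← Complex.normSq_eq_norm_sq, Complex.normSq_apply, ← hcirc v]
      simp only [p]
      ring
    nlinarith [norm_nonneg (p v)]
  have hrep : ∀ e : G.edgeSet, ∃ u v, G.Adj u v ∧ (e : Sym2 V) = s(u, v) := by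
    rintro ⟨e, he⟩
    induction e using Sym2.ind with
    | _ u v => exact ⟨u, v, he, rfl⟩
  choose u v huv he using hrep
  have hpne : ∀ e, p (u e) ≠ p (v e) := fun e h => (huv e).ne (hp h)
  refine ⟨p, fun e => ⟨fun t => AffineMap.lineMap (p (u e)) (p (v e)) (t : ℝ), by fun_prop⟩, hp,
    fun w => mem_sphere_zero_iff_norm.2 (hpn w), fun e => ?_, fun e t => ?_, fun e => ?_,
    fun e t ht => ?_, fun e e' hee t ht t' ht' h => ?_⟩
  · intro t t' h
    exact Subtype.ext (AffineMap.lineMap_injective ℝ (hpne e) h)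
  · have hmem : ∀ w, p w ∈ Metric.closedBall (0 : ℂ) 1 := fun w =>
      mem_closedBall_zero_iff.2 (hpn w).le
    exact (convex_closedBall (0 : ℂ) 1).lineMap_mem (hmem _) (hmem _) t.2
  · simp [he e]
  · rintro ⟨w, hw⟩
    have hlt : ‖p w‖ < 1 := by
      rw [hw]
      simp only [ContinuousMap.coe_mk, AffineMap.lineMap_apply_module]
      exact norm_combo_lt_of_ne (hpn _).le (hpn _).le (hpne e)
        (sub_pos.2 (by exact_mod_cast ht.2)) (by exact_mod_cast ht.1) (by ring)
    exact hlt.ne (hpn w)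
  · have hs := hside (u e) (v e) (u e') (v e') (huv e) (huv e')
      (fun hs => hee (Subtype.ext (by rw [he, he, hs])))
    have h1 := congrArg Complex.re h
    have h2 := congrArg Complex.im h
    have ht0 : (0 : ℝ) < t' := by exact_mod_cast ht'.1
    have ht1 : (t' : ℝ) < 1 := by exact_mod_cast ht'.2
    simp only [ContinuousMap.coe_mk, AffineMap.lineMap_apply_module, Complex.add_re,
      Complex.add_im, Complex.real_smul, Complex.re_ofReal_mul, Complex.im_ofReal_mul, p] at h1 h2
    -- A common point lies on the line of `e`, so this weighted mean of the areas vanishes. The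
    -- areas are weakly of one sign and not both zero, and both weights are positive.
    have key : (1 - (t' : ℝ)) * signedArea (q (u e)) (q (v e)) (q (u e')) +
        t' * signedArea (q (u e)) (q (v e)) (q (v e')) = 0 := by
      unfold signedArea
      linear_combination ((q (v e)).2 - (q (u e)).2) * h1 - ((q (v e)).1 - (q (u e)).1) * h2
    rcases hs with ⟨ha, hb, hab⟩ | ⟨ha, hb, hab⟩
    · rcases ha.eq_or_lt with ha | ha
      · nlinarith
      · nlinarith [mul_pos (sub_pos.2 ht1) ha, mul_nonneg ht0.le hb]
    · rcases ha.eq_or_lt with ha | ha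
      · nlinarith
      · nlinarith [mul_pos (sub_pos.2 ht1) (neg_pos.2 ha), mul_nonneg ht0.le (neg_nonneg.2 hb)]

end SimpleGraph

/-! ### Outerplanarity of `F` and the conclusion. -/

namespace SignedGraph

/-- Positions of the vertices of `F` on the circle of radius five. -/
def positionF : Fin 6 → ℤ × ℤ := ![(5, 0), (-3, 4), (-3, -4), (3, -4), (3, 4), (-5, 0)]

/-- In the cyclic order `x, b, y, c, z, a` the edges are the sides of a hexagon and the triangle
`xyz` inscribed in it. Integer points on the circle of radius five make the side conditions
decidable. -/
theorem F_isOuterplanar : F.graph.IsOuterplanar := by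
  have harea : ∀ u v w : Fin 6,
      SimpleGraph.signedArea (((positionF u).1 / 5, (positionF u).2 / 5) : ℝ × ℝ)
        ((positionF v).1 / 5, (positionF v).2 / 5) ((positionF w).1 / 5, (positionF w).2 / 5) =
      (SimpleGraph.signedArea (positionF u) (positionF v) (positionF w) : ℤ) / 25 := by
    intro u v w
    simp only [SimpleGraph.signedArea]
    push_cast
    ring
  refine SimpleGraph.isOuterplanar_of_signedArea
    (fun v => ((positionF v).1 / 5, (positionF v).2 / 5)) ?_ ?_ ?_
  · intro u v h
    have h1 := congrArg Prod.fst h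
    have h2 := congrArg Prod.snd h
    simp only at h1 h2
    have h1 : ((positionF u).1 : ℝ) = (positionF v).1 := by linarith
    have h2 : ((positionF u).2 : ℝ) = (positionF v).2 := by linarith
    have hinj : Function.Injective positionF := by decide
    exact hinj (Prod.ext (by exact_mod_cast h1) (by exact_mod_cast h2))
  · intro v
    have h : ∀ v, (positionF v).1 ^ 2 + (positionF v).2 ^ 2 = 25 := by decide
    have h' : ((positionF v).1 : ℝ) ^ 2 + ((positionF v).2 : ℝ) ^ 2 = 25 := by exact_mod_cast h v
    simp only
    linarith
  · have hint : ∀ u v a b : Fin 6,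
        s(u, v) ∈ ({s(1, 4), s(0, 3), s(2, 5)} ∪
          {s(0, 1), s(1, 2), s(0, 2), s(1, 5), s(0, 4), s(2, 3)} : Finset (Sym2 (Fin 6))) →
        s(a, b) ∈ ({s(1, 4), s(0, 3), s(2, 5)} ∪
          {s(0, 1), s(1, 2), s(0, 2), s(1, 5), s(0, 4), s(2, 3)} : Finset (Sym2 (Fin 6))) →
        s(u, v) ≠ s(a, b) →
        (0 ≤ SimpleGraph.signedArea (positionF u) (positionF v) (positionF a) ∧
          0 ≤ SimpleGraph.signedArea (positionF u) (positionF v) (positionF b) ∧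
          0 < SimpleGraph.signedArea (positionF u) (positionF v) (positionF a) +
            SimpleGraph.signedArea (positionF u) (positionF v) (positionF b)) ∨
        (SimpleGraph.signedArea (positionF u) (positionF v) (positionF a) ≤ 0 ∧
          SimpleGraph.signedArea (positionF u) (positionF v) (positionF b) ≤ 0 ∧
          SimpleGraph.signedArea (positionF u) (positionF v) (positionF a) +
            SimpleGraph.signedArea (positionF u) (positionF v) (positionF b) < 0) := by
      decide
    intro u v a b huv hab hne
    rw [harea, harea]
    have := hint u v a b ((SimpleGraph.fromEdgeSet_adj _).1 huv).1
      ((SimpleGraph.fromEdgeSet_adj _).1 hab).1 hne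
    rcases this with ⟨h1, h2, h3⟩ | ⟨h1, h2, h3⟩ <;> rify at h1 h2 h3
    · exact Or.inl ⟨by linarith, by linarith, by linarith⟩
    · exact Or.inr ⟨by linarith, by linarith, by linarith⟩

theorem F_circularChromaticNumber : F.circularChromaticNumber = 10 / 3 := by
  have hF := F.circularColorable_of_isSeriesParallel F_isOuterplanar.isSeriesParallel
  refine le_antisymm (circularChromaticNumber_le (by norm_num) hF) ?_
  exact le_csInf ⟨10 / 3, by norm_num, hF⟩ fun r hr =>
    ten_thirds_le_of_F_circularColorable (by linarith [hr.1]) hr.2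

/-- Every class of series-parallel graphs that contains the graph of `F` has circular chromatic number
`10 / 3`. -/
theorem isLUB_circularChromaticNumbers {P : ∀ V : Type, SimpleGraph V → Prop}
    (hP : ∀ (V : Type) (G : SimpleGraph V), P V G → G.IsSeriesParallel) (hF : P (Fin 6) F.graph) :
    IsLUB (circularChromaticNumbers P) (10 / 3 : ℝ) := by
  refine IsGreatest.isLUB ⟨⟨Fin 6, inferInstance, F, hF, F_circularChromaticNumber.symm⟩, ?_⟩
  rintro _ ⟨V, hV, S, hS, rfl⟩
  exact circularChromaticNumber_le (by norm_num) (S.circularColorable_of_isSeriesParallel (hP V _ hS))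

end SignedGraph

theorem mainTheorem3 :
    IsLUB (SignedGraph.circularChromaticNumbers fun _ G => G.IsSeriesParallel) (10 / 3 : ℝ) ∧
    IsLUB (SignedGraph.circularChromaticNumbers fun _ G => G.IsOuterplanar) (10 / 3 : ℝ) ∧
    (SignedGraph.F.graph.IsOuterplanar ∧
      ¬ SignedGraph.F.CircularColorable 3 ∧
      SignedGraph.F.circularChromaticNumber = 10 / 3) ∧
    (∀ (V : Type*) [Finite V] (S : SignedGraph V),
      S.graph.IsSeriesParallel → S.SwitchingHom SignedGraph.SPal5) := by
  refine ⟨SignedGraph.isLUB_circularChromaticNumbers (fun _ _ h => h)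
      SignedGraph.F_isOuterplanar.isSeriesParallel,
    SignedGraph.isLUB_circularChromaticNumbers (fun _ _ h => h.isSeriesParallel)
      SignedGraph.F_isOuterplanar,
    ⟨SignedGraph.F_isOuterplanar, fun h => ?_, SignedGraph.F_circularChromaticNumber⟩,
    fun V _ S hS => S.switchingHom_SPal5 hS⟩
  have := SignedGraph.ten_thirds_le_of_F_circularColorable (by norm_num) h
  norm_num at this
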